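/- A hypergraph is a pair $G=(V,E)$ with $V$ a finite set of vertices and $E$ a set of subsets of $V$ (hyperedges), each of cardinality at least $2$. A walk of length $k\ge 0$ is a sequence $(v_0,e_1,v_1,\dots,e_k,v_k)$ of vertices $v_i$ and hyperedges $e_i$ with $v_{i-1},v_i\in e_i$; it is a cycle if $k\ge 2$, $v_k=v_0$, the vertices $v_0,\dots,v_{k-1}$ are distinct and the hyperedges $e_1,\dots,e_k$ are distinct. The connected components of $G$ correspond to the classes of the equivalence relation "connected by a walk" on $V$. A hyperforest is a hypergraph without cycles; a hypertree is a connected hyperforest; the components of a hyperforest are hypertrees. A sub-hypergraph is spanning if it has all the vertices. For $n\ge 1$ let $\overline{\mathcal K}_n$ be the hypergraph on $n$ vertices whose hyperedges are all subsets of cardinality at least $2$. Let $\left\{{m\atop k}\right\}$ be the Stirling numbers of the second kind and $b_m(x)=\sum_{k\ge 0}\left\{{m\atop k}\right\}x^k$ the Bell polynomials. Then for all $n\ge1$ and $p\ge0$ the number $u_{n,p}$ of unrooted spanning hyperforests of $\overline{\mathcal K}_n$ with exactly $p$ connected components (hypertrees) is $$u_{n,p}=\sum_{s=1}^{n}\binom{n-1}{s-1}\,b_{n-s}(n)\sum_{\substack{q\ge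 0\\ p+q\le s}}(-1)^{s-p-q}\binom{p}{s-p-q}\left\{{p+q\atop p}\right\}\frac{s!}{(p+q)!}$$ $$\phantom{u_{n,p}}=\sum_{s=1}^{n}\binom{n-1}{s-1}\sum_{r\ge0}\left\{{n-s\atop r}\right\}n^r\sum_{\substack{q\ge 0\\ p+q\le s}}(-1)^{s-p-q}\binom{p}{s-p-q}\left\{{p+q\atop p}\right\}\frac{s!}{(p+q)!}.$$ In particular, the number $u_n=u_{n,1}$ of unrooted spanning hypertrees of $\overline{\mathcal K}_n$ is $$u_n=\frac{t_n}{n}=\frac{b_{n-1}(n)}{n}=\sum_{r\ge0}\left\{{n-1\atop r}\right\}n^{r-1},$$ where $t_n$ is the number of rooted spanning hypertrees of $\overline{\mathcal K}_n$, that is, of pairs consisting of a spanning hypertree and a vertex of it. -/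

import Mathlib

open Finset

namespace Hypergraph

/-- A walk `(v₀, e₁, v₁, …, e_k, v_k)` of length `k` in a hypergraph: `vert i` is `v_i` for
`0 ≤ i ≤ k` and `edge i` is the hyperedge `e_{i+1}`, which contains `v_i` and `v_{i+1}`. -/
structure Walk {V : Type*} (H : Hypergraph V) where
  length : ℕ
  vert : Fin (length + 1) → V
  edge : Fin length → Set V
  vert_mem : ∀ i, vert i ∈ H.vertexSet
  edge_mem : ∀ i, edge i ∈ H.edgeSet
  left_mem : ∀ i : Fin length, vert i.castSucc ∈ edge i
  right_mem : ∀ i : Fin length, vert i.succ ∈ edge i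

/-- A cycle is a walk of length `k ≥ 2` with `v_k = v₀`, in which `v₀, …, v_{k-1}` are distinct
vertices and `e₁, …, e_k` are distinct hyperedges. -/
def Walk.IsCycle {V : Type*} {H : Hypergraph V} (w : H.Walk) : Prop :=
  2 ≤ w.length ∧
  w.vert (Fin.last w.length) = w.vert 0 ∧
  Function.Injective (fun i : Fin w.length => w.vert i.castSucc) ∧
  Function.Injective w.edge

/-- The vertices `x` and `y` can be connected by a walk. -/
def Joined {V : Type*} (H : Hypergraph V) (x y : V) : Prop :=
  ∃ w : H.Walk, w.vert 0 = x ∧ w.vert (Fin.last w.length) = y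

/-- The vertex sets of the connected components: the classes of the relation of being connected
by a walk. -/
def componentVertexSets {V : Type*} (H : Hypergraph V) : Set (Set V) :=
  {C | ∃ x ∈ H.vertexSet, C = {y | H.Joined x y}}

/-- The number `c(H)` of connected components. -/
noncomputable def numComponents {V : Type*} (H : Hypergraph V) : ℕ :=
  H.componentVertexSets.ncard

/-- Every pair of vertices can be connected by a walk. -/
def IsConnected {V : Type*} (H : Hypergraph V) : Prop :=
  ∀ x ∈ H.vertexSet, ∀ y ∈ H.vertexSet, H.Joined x y

/-- A hyperforest is a hypergraph without cycles. -/
def IsHyperforest {V : Type*} (H : Hypergraph V) : Prop :=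
  ∀ w : H.Walk, ¬ w.IsCycle

/-- A hypertree is a connected hyperforest. -/
def IsHypertree {V : Type*} (H : Hypergraph V) : Prop :=
  H.IsConnected ∧ H.IsHyperforest

/-- `H` is a spanning sub-hypergraph of `G`. -/
def IsSpanningSub {V : Type*} (H G : Hypergraph V) : Prop :=
  H.vertexSet = G.vertexSet ∧ H.edgeSet ⊆ G.edgeSet

/-- The hypergraph on the vertex set `V` whose hyperedges are all subsets of `V` with at least two
elements. (Mathlib's `Hypergraph.completeOn` also has the empty set and the singletons
as edges.) -/
def completeAtLeastTwo (V : Type*) : Hypergraph V where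
  vertexSet := Set.univ
  edgeSet := {A | 2 ≤ A.ncard}
  subset_vertexSet_of_mem_edgeSet' := fun _ _ => Set.subset_univ _

/-- The number of unrooted spanning hyperforests of `G` which consist of `p` hypertrees
(connected components). -/
noncomputable def numSpanningHyperforests {V : Type*} (G : Hypergraph V) (p : ℕ) : ℕ :=
  {F : Hypergraph V | F.IsSpanningSub G ∧ F.IsHyperforest ∧ F.numComponents = p}.ncard

/-- The number of unrooted spanning hypertrees of `G`. -/
noncomputable def numSpanningHypertrees {V : Type*} (G : Hypergraph V) : ℕ :=
  {T : Hypergraph V | T.IsSpanningSub G ∧ T.IsHypertree}.ncard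

/-- The number of rooted spanning hypertrees of `G`, i.e. of spanning hypertrees with a
distinguished vertex. -/
noncomputable def numRootedSpanningHypertrees {V : Type*} (G : Hypergraph V) : ℕ :=
  {T : Hypergraph V × V |
    T.1.IsSpanningSub G ∧ T.1.IsHypertree ∧ T.2 ∈ T.1.vertexSet}.ncard

end Hypergraph

/-- The Bell (exponential) polynomial `b_m(x) = ∑_k S(m, k) x ^ k`. -/
noncomputable def bellPolynomial (m : ℕ) : Polynomial ℚ :=
  ∑ k ∈ range (m + 1), Polynomial.C (Nat.stirlingSecond m k : ℚ) * Polynomial.X ^ k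

/-! Let `a(k, m)` be the number of pairs of a hyperforest with `k + m` components and a set `R` of
`k` vertices in different components (roots). The forests sought are counted by `a(0, p)`, and `a(1,
0) = n * a(0, 1)`. Two double counts determine all `a(k, m)`; both rest on Euler's formula: the
number of vertices minus the sum of `#e - 1` over the edges is the number of components.

With every component rooted (`m = 0`), Euler's formula is summed over all rooted forests. Deleting a
marked edge with `j + 1` vertices leaves one of its vertices attached to the old root and makes the
other `j` into new roots (`sum_card_edges`). The resulting recursion in `k` is the Bell polynomial
identity `mul_bellPolynomial_eval`, whence `a(s, 0) = (n - 1).choose (s - 1) * b_{n-s}(n)`.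

For general `m`, Euler's formula is applied to the components without a root. A marked free vertex
becomes a root, and a marked free edge is deleted while all its vertices become roots
(`card_rootedForests_succ`). With `A_m(x) = ∑ a(k, m) x ^ k` and `D = d/dx`, this reads `(m + 1)
A_{m+1} = φ(D) A_m` where `φ(t) = (1 - t)(exp t - 1)`. So `A_p = φ(D) ^ p / p! A_0`, which is
`card_rootedForests`; its constant term is the claimed sum, `forestCoeff` being read off from `φ ^ p
/ p!`. -/

namespace EdgeFamily

/-! ### Components, forests and Euler's formula for families of edges -/

section Connectivity

variable {V : Type*}

/-- The equivalence relation on the vertices generated by lying in a common edge. -/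
def conn (E : Finset (Finset V)) : Setoid V :=
  Relation.EqvGen.setoid fun x y => ∃ e ∈ E, x ∈ e ∧ y ∈ e

lemma conn_of_mem {E : Finset (Finset V)} {e : Finset V} {x y : V} (he : e ∈ E) (hx : x ∈ e)
    (hy : y ∈ e) : conn E x y :=
  Relation.EqvGen.rel _ _ ⟨e, he, hx, hy⟩

lemma conn_le {E : Finset (Finset V)} {s : Setoid V}
    (h : ∀ e ∈ E, ∀ x ∈ e, ∀ y ∈ e, s x y) : conn E ≤ s :=
  Setoid.eqvGen_le fun x y ⟨e, he, hx, hy⟩ => h e he x hx y hy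

lemma conn_mono {E F : Finset (Finset V)} (h : E ⊆ F) {x y : V} (hxy : conn E x y) :
    conn F x y :=
  conn_le (s := conn F) (fun _ he _ hx _ hy => conn_of_mem (h he) hx hy) hxy

lemma conn_refl (E : Finset (Finset V)) (x : V) : conn E x x := (conn E).refl x

lemma conn_symm {E : Finset (Finset V)} {x y : V} (h : conn E x y) : conn E y x := (conn E).symm h

lemma conn_trans {E : Finset (Finset V)} {x y z : V} (h : conn E x y) (h' : conn E y z) :
    conn E x z := (conn E).trans h h'

/-- The vertices of `R` lie in pairwise different components. -/
def Indep (E : Finset (Finset V)) (R : Finset V) : Prop :=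
  ∀ x ∈ R, ∀ y ∈ R, conn E x y → x = y

lemma Indep.mono {E F : Finset (Finset V)} {R S : Finset V} (h : Indep F S) (hE : E ⊆ F)
    (hR : R ⊆ S) : Indep E R :=
  fun x hx y hy hxy => h x (hR hx) y (hR hy) (conn_mono hE hxy)

lemma Indep.notMem {E : Finset (Finset V)} {e : Finset V} (h : Indep E e) (he : 2 ≤ #e) :
    e ∉ E := by
  intro heE
  obtain ⟨a, ha, b, hb, hab⟩ := one_lt_card.1 (show 1 < #e from he)
  exact hab (h a ha b hb (conn_of_mem heE ha hb))

variable [DecidableEq V]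

/-- A new edge fuses the classes that it meets and leaves the others alone; the right-hand side is
already an equivalence relation containing all edges, so it contains the generated one. -/
lemma conn_insert_iff {E : Finset (Finset V)} {e : Finset V} {x y : V} :
    conn (insert e E) x y ↔
      conn E x y ∨ (∃ a ∈ e, conn E x a) ∧ ∃ b ∈ e, conn E y b := by
  constructor
  · let s : Setoid V :=
      { r := fun x y => conn E x y ∨ (∃ a ∈ e, conn E x a) ∧ ∃ b ∈ e, conn E y b
        iseqv :=
          { refl := fun x => Or.inl (conn_refl E x)
            symm := by
              rintro x y (h | ⟨h, h'⟩)
              · exact Or.inl (conn_symm h)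
              · exact Or.inr ⟨h', h⟩
            trans := by
              rintro x y z (h | ⟨h, h'⟩) (k | ⟨⟨a, ha, k⟩, k'⟩)
              · exact Or.inl (conn_trans h k)
              · exact Or.inr ⟨⟨a, ha, conn_trans h k⟩, k'⟩
              · obtain ⟨b, hb, hyb⟩ := h'
                exact Or.inr ⟨h, b, hb, conn_trans (conn_symm k) hyb⟩
              · exact Or.inr ⟨h, k'⟩ } }
    intro h
    refine conn_le (s := s) ?_ h
    intro f hf x hx y hy
    rcases Finset.mem_insert.1 hf with rfl | hf
    · exact Or.inr ⟨⟨x, hx, conn_refl E x⟩, y, hy, conn_refl E y⟩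
    · exact Or.inl (conn_of_mem hf hx hy)
  · rintro (h | ⟨⟨a, ha, h⟩, b, hb, h'⟩)
    · exact conn_mono (subset_insert _ _) h
    · have hab : conn (insert e E) a b := conn_of_mem (mem_insert_self _ _) ha hb
      exact conn_trans (conn_mono (subset_insert _ _) h)
        (conn_trans hab (conn_symm (conn_mono (subset_insert _ _) h')))

/-- A family of edges of size at least two such that the removal of any edge separates all of its
vertices. -/
structure Forest (E : Finset (Finset V)) : Prop where
  two_le_card : ∀ e ∈ E, 2 ≤ #e
  indep_erase : ∀ e ∈ E, Indep (E.erase e) e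

lemma Forest.mono {E F : Finset (Finset V)} (h : Forest F) (hE : E ⊆ F) : Forest E :=
  ⟨fun e he => h.two_le_card e (hE he),
    fun e he => (h.indep_erase e (hE he)).mono (erase_subset_erase e hE) subset_rfl⟩

lemma forest_empty : Forest (∅ : Finset (Finset V)) := ⟨by simp, by simp⟩

/-- Suppose two vertices of an old edge `f` become connected through `e` after `f` is removed. The
vertices of `e` where the connection enters and leaves are joined in `E` through `f`, so they
coincide by independence, and `e` was not needed. -/
lemma Forest.insert {E : Finset (Finset V)} {e : Finset V} (h : Forest E) (he : 2 ≤ #e)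
    (hi : Indep E e) : Forest (insert e E) := by
  have heE := hi.notMem he
  refine ⟨fun f hf => ?_, fun f hf => ?_⟩
  · rcases mem_insert.1 hf with rfl | hf
    exacts [he, h.two_le_card f hf]
  · rcases mem_insert.1 hf with rfl | hf
    · rwa [erase_insert heE]
    · have hne : e ≠ f := by rintro rfl; exact heE hf
      rw [erase_insert_of_ne hne]
      intro x hx y hy hxy
      rcases conn_insert_iff.1 hxy with hxy | ⟨⟨a, ha, hxa⟩, b, hb, hyb⟩
      · exact h.indep_erase f hf x hx y hy hxy
      · have hab : a = b := by
          refine hi a ha b hb ?_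
          exact conn_trans (conn_symm (conn_mono (erase_subset _ _) hxa))
            (conn_trans (conn_of_mem hf hx hy) (conn_mono (erase_subset _ _) hyb))
        subst hab
        exact h.indep_erase f hf x hx y hy (conn_trans hxa (conn_symm hyb))

/-- The number of components. -/
noncomputable def numComp [Fintype V] (E : Finset (Finset V)) : ℕ :=
  Nat.card (Quotient (conn E))

variable [Fintype V]

omit [DecidableEq V] in
lemma Indep.card_le {E : Finset (Finset V)} {R : Finset V} (h : Indep E R) :
    #R ≤ numComp E := by
  have hinj : Function.Injective (fun x : R => (Quotient.mk (conn E) x.1)) := by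
    rintro ⟨x, hx⟩ ⟨y, hy⟩ hxy
    exact Subtype.ext (h x hx y hy (Quotient.exact hxy))
  simpa [numComp] using Nat.card_le_card_of_injective _ hinj

omit [DecidableEq V] in
lemma numComp_eq_card {E : Finset (Finset V)} {R : Finset V} (h : Indep E R)
    (hR : ∀ v, ∃ r ∈ R, conn E v r) : numComp E = #R := by
  have hbij : Function.Bijective (fun x : R => (Quotient.mk (conn E) x.1)) := by
    constructor
    · rintro ⟨x, hx⟩ ⟨y, hy⟩ hxy
      exact Subtype.ext (h x hx y hy (Quotient.exact hxy))
    · intro q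
      induction q using Quotient.inductionOn with
      | h v =>
        obtain ⟨r, hr, hvr⟩ := hR v
        exact ⟨⟨r, hr⟩, Quotient.sound (conn_symm hvr)⟩
  simpa [numComp] using (Nat.card_eq_of_bijective _ hbij).symm

lemma Indep.exists_conn {E : Finset (Finset V)} {R : Finset V} (h : Indep E R)
    (hR : #R = numComp E) (v : V) : ∃ r ∈ R, conn E v r := by
  by_contra! hv
  have hi : Indep E (Insert.insert v R) := by
    intro x hx y hy hxy
    rcases mem_insert.1 hx with rfl | hx' <;> rcases mem_insert.1 hy with rfl | hy'
    · rfl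
    · exact absurd hxy (hv y hy')
    · exact absurd (conn_symm hxy) (hv x hx')
    · exact h x hx' y hy' hxy
  have hvR : v ∉ R := fun hvR => hv v hvR (conn_refl E v)
  have := hi.card_le
  rw [card_insert_of_notMem hvR] at this
  omega

/-- A partial transversal of the components extends to a transversal. -/
lemma Indep.exists_transversal {E : Finset (Finset V)} {R : Finset V} (h : Indep E R) :
    ∃ S, R ⊆ S ∧ Indep E S ∧ #S = numComp E := by
  classical
  obtain ⟨S, hS, hmax⟩ := (univ.filter fun S : Finset V => R ⊆ S ∧ Indep E S).exists_max_image
    (fun S => #S) ⟨R, by simp [h]⟩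
  simp only [mem_filter, mem_univ, true_and] at hS hmax
  refine ⟨S, hS.1, hS.2, (numComp_eq_card hS.2 fun v => ?_).symm⟩
  by_contra! hv
  have hvS : v ∉ S := fun hvS => hv v hvS (conn_refl E v)
  have := hmax (Insert.insert v S) ⟨hS.1.trans (subset_insert _ _), by
    intro x hx y hy hxy
    rcases mem_insert.1 hx with rfl | hx' <;> rcases mem_insert.1 hy with rfl | hy'
    · rfl
    · exact absurd hxy (hv y hy')
    · exact absurd (conn_symm hxy) (hv x hx')
    · exact hS.2 x hx' y hy' hxy⟩
  rw [card_insert_of_notMem hvS] at this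
  omega

/-- An edge joining `#e` components into one. -/
lemma numComp_insert {E : Finset (Finset V)} {e : Finset V} (he : e.Nonempty) (hi : Indep E e) :
    numComp E = numComp (insert e E) + (#e - 1) := by
  obtain ⟨S, heS, hS, hcard⟩ := hi.exists_transversal
  obtain ⟨v, hv⟩ := he
  have hvS : v ∉ S \ e := by simp [hv]
  have key : numComp (insert e E) = #(insert v (S \ e)) := by
    apply numComp_eq_card
    · have aux : ∀ x ∈ S \ e, ∀ a ∈ e, ¬ conn E x a := by
        intro x hx a ha hxa
        rw [mem_sdiff] at hx
        exact hx.2 (hS x hx.1 a (heS ha) hxa ▸ ha)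
      intro x hx y hy hxy
      rcases conn_insert_iff.1 hxy with hxy | ⟨⟨a, ha, hxa⟩, b, hb, hyb⟩
      · have hsub : insert v (S \ e) ⊆ S := insert_subset (heS hv) sdiff_subset
        exact hS x (hsub hx) y (hsub hy) hxy
      · rcases mem_insert.1 hx with rfl | hx' <;> rcases mem_insert.1 hy with rfl | hy'
        · rfl
        · exact absurd hyb (aux y hy' b hb)
        · exact absurd hxa (aux x hx' a ha)
        · exact absurd hxa (aux x hx' a ha)
    · intro w
      obtain ⟨r, hr, hwr⟩ := hS.exists_conn hcard w
      by_cases hre : r ∈ e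
      · exact ⟨v, mem_insert_self _ _, conn_insert_iff.2
          (Or.inr ⟨⟨r, hre, hwr⟩, v, hv, conn_refl E v⟩)⟩
      · exact ⟨r, by simp [hr, hre], conn_mono (subset_insert _ _) hwr⟩
  rw [key, card_insert_of_notMem hvS, card_sdiff_of_subset heS, ← hcard]
  have := card_le_card heS
  have : 0 < #e := card_pos.2 ⟨v, hv⟩
  omega

/-- Euler's formula for hyperforests, relative to a subfamily of the edges. -/
lemma Forest.numComp_eq_add_sum {E G : Finset (Finset V)} (hF : Forest (G ∪ E))
    (hd : Disjoint G E) : numComp E = numComp (G ∪ E) + ∑ e ∈ G, (#e - 1) := by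
  induction G using Finset.induction_on with
  | empty => simp
  | insert f G hf ih =>
    rw [disjoint_insert_left] at hd
    rw [insert_union] at hF ⊢
    have hfG : f ∉ G ∪ E := by simp [hf, hd.1]
    have h1 := hF.indep_erase f (mem_insert_self _ _)
    rw [erase_insert hfG] at h1
    have h2 := hF.two_le_card f (mem_insert_self _ _)
    rw [ih (hF.mono (subset_insert _ _)) hd.2,
      numComp_insert (card_pos.1 (by omega)) h1, sum_insert hf]
    omega

omit [DecidableEq V] in
lemma numComp_empty : numComp (∅ : Finset (Finset V)) = Fintype.card V := by
  refine numComp_eq_card (R := univ) (fun x _ y _ h => ?_) fun v => ⟨v, mem_univ v, conn_refl _ v⟩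
  exact conn_le (s := ⊥) (E := ∅) (by simp) h

/-- The vertices whose component does not meet `R`. -/
noncomputable def freeVerts (E : Finset (Finset V)) (R : Finset V) : Finset V :=
  open Classical in univ.filter fun v => ∀ r ∈ R, ¬ conn E v r

/-- The edges whose component does not meet `R`. -/
noncomputable def freeEdges (E : Finset (Finset V)) (R : Finset V) : Finset (Finset V) :=
  open Classical in E.filter fun e => ∀ x ∈ e, ∀ r ∈ R, ¬ conn E x r

lemma mem_freeVerts {E : Finset (Finset V)} {R : Finset V} {v : V} :
    v ∈ freeVerts E R ↔ ∀ r ∈ R, ¬ conn E v r := by simp [freeVerts]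

lemma mem_freeEdges {E : Finset (Finset V)} {R : Finset V} {e : Finset V} :
    e ∈ freeEdges E R ↔ e ∈ E ∧ ∀ x ∈ e, ∀ r ∈ R, ¬ conn E x r := by simp [freeEdges]

/-- Deleting the free edges isolates every free vertex and does not touch the components that meet
`R`, so the free vertices together with `R` form a transversal of what remains. -/
lemma numComp_sdiff_freeEdges {E : Finset (Finset V)} {R : Finset V} (h : Indep E R) :
    numComp (E \ freeEdges E R) = #(freeVerts E R) + #R := by
  set F := E \ freeEdges E R with hF
  set U := freeVerts E R with hU
  have hUE : ∀ {x y}, conn E x y → x ∈ U → y ∈ U := by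
    intro x y hxy hx
    rw [hU, mem_freeVerts] at hx ⊢
    exact fun r hr hyr => hx r hr (conn_trans hxy hyr)
  have hmem : ∀ e ∈ F, ∀ x ∈ e, x ∉ U := by
    intro e he x hx hxU
    rw [hF, mem_sdiff] at he
    refine he.2 (mem_freeEdges.2 ⟨he.1, fun y hy => ?_⟩)
    exact mem_freeVerts.1 (hUE (conn_of_mem he.1 hx hy) hxU)
  have hiso : ∀ {x y}, conn F x y → x ∈ U → x = y := by
    let s : Setoid V :=
      { r := fun x y => x = y ∨ x ∉ U ∧ y ∉ U
        iseqv := ⟨fun _ => Or.inl rfl, fun h => by tauto, by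
          rintro x y z (rfl | h) (rfl | k)
          · exact Or.inl rfl
          · exact Or.inr k
          · exact Or.inr h
          · exact Or.inr ⟨h.1, k.2⟩⟩ }
    intro x y hxy hx
    have := conn_le (s := s) (fun e he x hx y hy => Or.inr ⟨hmem e he x hx, hmem e he y hy⟩) hxy
    rcases this with h | h
    exacts [h, absurd hx h.1]
  -- The union of `conn F` with the total relation on `U` is transitive because `F` isolates the
  -- vertices of `U`, and it contains every edge of `E`, free or not.
  have hconn : ∀ {x y}, conn E x y → x ∉ U → conn F x y := by
    let s : Setoid V :=
      { r := fun x y => (x ∈ U ∧ y ∈ U) ∨ conn F x y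
        iseqv := ⟨fun x => Or.inr (conn_refl F x), fun h => h.imp And.symm conn_symm, by
          rintro x y z (h | h) (k | k)
          · exact Or.inl ⟨h.1, k.2⟩
          · exact Or.inl ⟨h.1, hiso k h.2 ▸ h.2⟩
          · exact Or.inl ⟨(hiso (conn_symm h) k.1) ▸ k.1, k.2⟩
          · exact Or.inr (conn_trans h k)⟩ }
    intro x y hxy hx
    have : s x y := by
      refine conn_le (s := s) (fun e he x hx y hy => ?_) hxy
      by_cases hf : e ∈ freeEdges E R
      · have := (mem_freeEdges.1 hf).2
        exact Or.inl ⟨mem_freeVerts.2 (this x hx), mem_freeVerts.2 (this y hy)⟩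
      · exact Or.inr (conn_of_mem (mem_sdiff.2 ⟨he, hf⟩) hx hy)
    rcases this with h | h
    exacts [absurd h.1 hx, h]
  have hd : Disjoint U R := by
    rw [disjoint_left]
    exact fun x hx hxR => mem_freeVerts.1 hx x hxR (conn_refl E x)
  rw [← card_union_of_disjoint hd]
  refine numComp_eq_card ?_ fun v => ?_
  · intro x hx y hy hxy
    rcases mem_union.1 hx with hx | hx
    · exact hiso hxy hx
    rcases mem_union.1 hy with hy | hy
    · exact (hiso (conn_symm hxy) hy).symm
    · exact h x hx y hy (conn_mono sdiff_subset hxy)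
  · by_cases hv : v ∈ U
    · exact ⟨v, mem_union_left _ hv, conn_refl F v⟩
    · have hv' := hv
      rw [hU, mem_freeVerts] at hv'
      push Not at hv'
      obtain ⟨r, hr, hvr⟩ := hv'
      exact ⟨r, mem_union_right _ hr, hconn hvr hv⟩

/-- Euler's formula for the components which do not meet `R`. -/
lemma Forest.card_freeVerts {E : Finset (Finset V)} {R : Finset V} (hE : Forest E)
    (h : Indep E R) :
    #(freeVerts E R) + #R = numComp E + ∑ e ∈ freeEdges E R, (#e - 1) := by
  have hsub : freeEdges E R ⊆ E := fun e he => (mem_freeEdges.1 he).1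
  have hu : freeEdges E R ∪ E \ freeEdges E R = E := union_sdiff_of_subset hsub
  have := Forest.numComp_eq_add_sum (E := E \ freeEdges E R) (G := freeEdges E R)
    (by rwa [hu]) disjoint_sdiff
  rw [hu] at this
  rw [← numComp_sdiff_freeEdges h, this]

end Connectivity

/-! ### Double counts of rooted forests -/

section Counting

variable {V : Type*} [DecidableEq V] [Fintype V]

variable (V) in
/-- The hyperforests with `k + m` components together with a choice of `k` vertices in
different components. -/
noncomputable def rootedForests (k m : ℕ) : Finset (Finset (Finset V) × Finset V) :=
  open Classical in univ.filter fun P =>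
    Forest P.1 ∧ Indep P.1 P.2 ∧ #P.2 = k ∧ numComp P.1 = k + m

lemma mem_rootedForests {k m : ℕ} {P : Finset (Finset V) × Finset V} :
    P ∈ rootedForests V k m ↔ Forest P.1 ∧ Indep P.1 P.2 ∧ #P.2 = k ∧ numComp P.1 = k + m := by
  simp [rootedForests]

/-- A marked free vertex is moved into `R`; conversely a marked root is released. The forest itself
does not change. -/
lemma sum_card_freeVerts (k m : ℕ) :
    ∑ P ∈ rootedForests V k (m + 1), #(freeVerts P.1 P.2) =
      (k + 1) * #(rootedForests V (k + 1) m) := by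
  have h : ∑ P ∈ rootedForests V (k + 1) m, #P.2 = (k + 1) * #(rootedForests V (k + 1) m) := by
    rw [sum_congr rfl fun P hP => (mem_rootedForests.1 hP).2.2.1, sum_const, smul_eq_mul, mul_comm]
  rw [← h, ← card_sigma, ← card_sigma]
  refine card_nbij' (fun x => ⟨(x.1.1, insert x.2 x.1.2), x.2⟩)
    (fun x => ⟨(x.1.1, x.1.2.erase x.2), x.2⟩) ?_ ?_ ?_ ?_
  · rintro ⟨⟨E, R⟩, v⟩ hx
    simp only [coe_sigma, Set.mem_sigma_iff, mem_coe, mem_rootedForests, mem_freeVerts] at hx ⊢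
    obtain ⟨⟨hE, hR, hk, hc⟩, hv⟩ := hx
    have hvR : v ∉ R := fun h => hv v h (conn_refl E v)
    refine ⟨⟨hE, ?_, by rw [card_insert_of_notMem hvR, hk], by omega⟩, mem_insert_self _ _⟩
    intro x hx y hy hxy
    rcases mem_insert.1 hx with rfl | hx' <;> rcases mem_insert.1 hy with rfl | hy'
    · rfl
    · exact absurd hxy (hv y hy')
    · exact absurd (conn_symm hxy) (hv x hx')
    · exact hR x hx' y hy' hxy
  · rintro ⟨⟨E, R⟩, v⟩ hx
    simp only [coe_sigma, Set.mem_sigma_iff, mem_coe, mem_rootedForests, mem_freeVerts] at hx ⊢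
    obtain ⟨⟨hE, hR, hk, hc⟩, hv⟩ := hx
    refine ⟨⟨hE, hR.mono subset_rfl (erase_subset _ _), by rw [card_erase_of_mem hv, hk]; rfl,
      by omega⟩, fun r hr hvr => ?_⟩
    exact (mem_erase.1 hr).1 (hR v hv r (mem_erase.1 hr).2 hvr).symm
  · rintro ⟨⟨E, R⟩, v⟩ hx
    simp only [coe_sigma, Set.mem_sigma_iff, mem_coe, mem_freeVerts] at hx
    have hvR : v ∉ R := fun h => hx.2 v h (conn_refl E v)
    simp [erase_insert hvR]
  · rintro ⟨⟨E, R⟩, v⟩ hx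
    simp only [coe_sigma, Set.mem_sigma_iff, mem_coe] at hx
    simp [insert_erase hx.2]

/-- A marked free edge is deleted and its vertices become roots; conversely `l` chosen roots are
joined by a new edge and released. Deletion adds `l - 1` components and `l` roots, so the number of
unrooted components drops by one. -/
lemma sum_card_freeEdges (k m l : ℕ) (hl : 2 ≤ l) :
    ∑ P ∈ rootedForests V k (m + 1), #((freeEdges P.1 P.2).filter fun e => #e = l) =
      (k + l).choose l * #(rootedForests V (k + l) m) := by
  have h : ∑ P ∈ rootedForests V (k + l) m, #(powersetCard l P.2) =
      (k + l).choose l * #(rootedForests V (k + l) m) := by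
    rw [sum_congr rfl fun P hP => by rw [card_powersetCard, (mem_rootedForests.1 hP).2.2.1],
      sum_const, smul_eq_mul, mul_comm]
  rw [← h, ← card_sigma, ← card_sigma]
  refine card_nbij' (fun x => ⟨(x.1.1.erase x.2, x.1.2 ∪ x.2), x.2⟩)
    (fun x => ⟨(insert x.2 x.1.1, x.1.2 \ x.2), x.2⟩) ?_ ?_ ?_ ?_
  · rintro ⟨⟨E, R⟩, e⟩ hx
    simp only [coe_sigma, Set.mem_sigma_iff, mem_coe, mem_rootedForests, mem_filter, mem_freeEdges,
      mem_powersetCard] at hx ⊢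
    obtain ⟨⟨hE, hR, hk, hc⟩, ⟨heE, hef⟩, hel⟩ := hx
    have hd : Disjoint R e := by
      rw [disjoint_left]
      exact fun x hx hxe => hef x hxe x hx (conn_refl E x)
    have hi := hE.indep_erase e heE
    have hne : e.Nonempty := card_pos.1 (by omega)
    have hcc := numComp_insert hne hi
    rw [insert_erase heE] at hcc
    refine ⟨⟨hE.mono (erase_subset _ _), ?_, by rw [card_union_of_disjoint hd]; omega, by omega⟩,
      subset_union_right, hel⟩
    intro x hx y hy hxy
    have hxy' := conn_mono (erase_subset _ _) hxy
    rcases mem_union.1 hx with hx | hx <;> rcases mem_union.1 hy with hy | hy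
    · exact hR x hx y hy hxy'
    · exact absurd (conn_symm hxy') (hef y hy x hx)
    · exact absurd hxy' (hef x hx y hy)
    · exact hi x hx y hy hxy
  · rintro ⟨⟨E, R⟩, e⟩ hx
    simp only [coe_sigma, Set.mem_sigma_iff, mem_coe, mem_rootedForests, mem_filter, mem_freeEdges,
      mem_powersetCard] at hx ⊢
    obtain ⟨⟨hE, hR, hk, hc⟩, heR, hel⟩ := hx
    have hi : Indep E e := hR.mono subset_rfl heR
    have hne : e.Nonempty := card_pos.1 (by omega)
    have hcc := numComp_insert hne hi
    have aux : ∀ x ∈ R \ e, ∀ a ∈ e, ¬ conn E x a := by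
      intro x hx a ha hxa
      rw [mem_sdiff] at hx
      exact hx.2 (hR x hx.1 a (heR ha) hxa ▸ ha)
    refine ⟨⟨hE.insert (by omega) hi, ?_, by rw [card_sdiff_of_subset heR]; omega, by omega⟩,
      ⟨mem_insert_self _ _, ?_⟩, hel⟩
    · intro x hx y hy hxy
      rcases conn_insert_iff.1 hxy with hxy | ⟨⟨a, ha, hxa⟩, -⟩
      · exact hR x (mem_sdiff.1 hx).1 y (mem_sdiff.1 hy).1 hxy
      · exact absurd hxa (aux x hx a ha)
    · intro x hx r hr hxr
      rcases conn_insert_iff.1 hxr with hxr | ⟨-, b, hb, hrb⟩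
      · exact aux r hr x hx (conn_symm hxr)
      · exact aux r hr b hb hrb
  · rintro ⟨⟨E, R⟩, e⟩ hx
    simp only [coe_sigma, Set.mem_sigma_iff, mem_coe, mem_filter, mem_freeEdges] at hx
    obtain ⟨-, ⟨heE, hef⟩, hel⟩ := hx
    have hd : Disjoint R e := by
      rw [disjoint_left]
      exact fun x hx hxe => hef x hxe x hx (conn_refl E x)
    simp [insert_erase heE, union_sdiff_cancel_right hd]
  · rintro ⟨⟨E, R⟩, e⟩ hx
    simp only [coe_sigma, Set.mem_sigma_iff, mem_coe, mem_rootedForests, mem_powersetCard] at hx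
    obtain ⟨⟨hE, hR, hk, hc⟩, heR, hel⟩ := hx
    have heE : e ∉ E := (hR.mono subset_rfl heR).notMem (by omega)
    simp [erase_insert heE, sdiff_union_of_subset heR]

omit [DecidableEq V] in
-- Groups the edges by `j = #e - 1`. A possible empty edge contributes `0` on the left by truncated
-- subtraction and matches no `j` on the right.
lemma sum_card_sub_one (F : Finset (Finset V)) :
    ∑ e ∈ F, (#e - 1) =
      ∑ j ∈ range (Fintype.card V + 1), j * #(F.filter fun e => #e = j + 1) := by
  have h0 : ∑ e ∈ F, (#e - 1) = ∑ e ∈ F, ∑ j ∈ range (Fintype.card V + 1),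
      if #e = j + 1 then j else 0 := by
    refine sum_congr rfl fun e _ => ?_
    have := card_le_univ e
    rcases Nat.eq_zero_or_pos (#e) with h | h
    · simp [h]
    · rw [sum_eq_single_of_mem (#e - 1) (mem_range.2 (by omega)) fun j _ hj => if_neg (by omega),
        if_pos (by omega)]
  rw [h0, sum_comm]
  refine sum_congr rfl fun l _ => ?_
  rw [← sum_filter, sum_const, smul_eq_mul, mul_comm]

/-- Euler's formula on the `m + 1` components without a root, summed over all rooted forests; the
two preceding bijections evaluate the sums. -/
lemma card_rootedForests_succ (k m : ℕ) :
    (m + 1) * #(rootedForests V k (m + 1)) + ∑ j ∈ range (Fintype.card V + 1),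
      j * ((k + (j + 1)).choose (j + 1) * #(rootedForests V (k + (j + 1)) m)) =
      (k + 1) * #(rootedForests V (k + 1) m) := by
  rw [← sum_card_freeVerts]
  have h : ∀ P ∈ rootedForests V k (m + 1), #(freeVerts P.1 P.2) =
      (m + 1) + ∑ j ∈ range (Fintype.card V + 1),
        j * #((freeEdges P.1 P.2).filter fun e => #e = j + 1) := by
    intro P hP
    rw [mem_rootedForests] at hP
    have := hP.1.card_freeVerts hP.2.1
    rw [← sum_card_sub_one]
    omega
  rw [sum_congr rfl h, sum_add_distrib, sum_const, smul_eq_mul, mul_comm, sum_comm]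
  congr 1
  refine sum_congr rfl fun j _ => ?_
  rw [← mul_sum]
  rcases Nat.eq_zero_or_pos j with rfl | hj
  · simp
  · rw [sum_card_freeEdges k m (j + 1) (by omega)]

/-- `R` is a full transversal, so exactly one root lies in the component of `v`, and it is the only
one to be avoided. -/
lemma card_filter_powersetCard {E : Finset (Finset V)} {R : Finset V} (hR : Indep E R)
    (hc : #R = numComp E) (j : ℕ) (v : V) [DecidablePred fun J : Finset V => ∀ x ∈ J, ¬ conn E v x] :
    #((powersetCard j R).filter fun J => ∀ x ∈ J, ¬ conn E v x) = (#R - 1).choose j := by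
  obtain ⟨r, hr, hvr⟩ := hR.exists_conn hc v
  rw [← card_erase_of_mem hr, ← card_powersetCard]
  congr 1
  ext J
  simp only [mem_filter, mem_powersetCard]
  constructor
  · rintro ⟨⟨hJ, hj⟩, h⟩
    exact ⟨subset_erase.2 ⟨hJ, fun hrJ => h r hrJ hvr⟩, hj⟩
  · rintro ⟨hJ, hj⟩
    refine ⟨⟨hJ.trans (erase_subset _ _), hj⟩, fun x hx hvx => ?_⟩
    have hx' := mem_erase.1 (hJ hx)
    exact hx'.1 (hR x hx'.2 r hr (conn_trans (conn_symm hvx) hvr))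

/-- When every component is rooted, deleting an edge `e` leaves exactly one vertex `v` of `e` joined
to the old root; the other `j` vertices become roots of the pieces cut off. Conversely one chooses
any vertex `v` and `j` roots outside its component, which gives the factors on the right. -/
lemma sum_card_edges (k j : ℕ) (hj : 1 ≤ j) :
    ∑ P ∈ rootedForests V k 0, #(P.1.filter fun e => #e = j + 1) =
      Fintype.card V * ((k + j - 1).choose j * #(rootedForests V (k + j) 0)) := by
  classical
  have h : ∑ P ∈ rootedForests V (k + j) 0, #((univ : Finset V).sigma fun v =>
      (powersetCard j P.2).filter fun J => ∀ x ∈ J, ¬ conn P.1 v x) =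
      Fintype.card V * ((k + j - 1).choose j * #(rootedForests V (k + j) 0)) := by
    have h' : ∀ P ∈ rootedForests V (k + j) 0, #((univ : Finset V).sigma fun v =>
        (powersetCard j P.2).filter fun J => ∀ x ∈ J, ¬ conn P.1 v x) =
        Fintype.card V * (k + j - 1).choose j := by
      intro P hP
      obtain ⟨-, hR, hk, hc⟩ := mem_rootedForests.1 hP
      rw [card_sigma, sum_congr rfl fun v _ => card_filter_powersetCard hR (by omega) j v,
        sum_const, hk, card_univ, smul_eq_mul]
    rw [sum_congr rfl h', sum_const, smul_eq_mul]
    ring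
  rw [← h, ← card_sigma, ← card_sigma]
  symm
  refine card_bij (fun x _ => ⟨(insert (insert x.2.1 x.2.2) x.1.1, x.1.2 \ x.2.2),
    insert x.2.1 x.2.2⟩) ?_ ?_ ?_
  · rintro ⟨⟨E, R⟩, v, J⟩ hx
    simp only [mem_sigma, mem_rootedForests, mem_filter, mem_powersetCard, mem_univ,
      true_and] at hx ⊢
    obtain ⟨⟨hE, hR, hk, hc⟩, ⟨hJR, hJ⟩, hv⟩ := hx
    have hvJ : v ∉ J := fun h => hv v h (conn_refl E v)
    have hcard : #(insert v J) = j + 1 := by rw [card_insert_of_notMem hvJ, hJ]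
    have hi : Indep E (insert v J) := by
      intro x hx y hy hxy
      rcases mem_insert.1 hx with rfl | hx' <;> rcases mem_insert.1 hy with rfl | hy'
      · rfl
      · exact absurd hxy (hv y hy')
      · exact absurd (conn_symm hxy) (hv x hx')
      · exact hR x (hJR hx') y (hJR hy') hxy
    have hcc := numComp_insert (insert_nonempty v J) hi
    refine ⟨⟨hE.insert (by omega) hi, ?_, by rw [card_sdiff_of_subset hJR]; omega, by omega⟩,
      mem_insert_self _ _, hcard⟩
    have aux : ∀ x ∈ R \ J, ∀ a ∈ insert v J, conn E x a → conn E x v := by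
      intro x hx a ha hxa
      rw [mem_sdiff] at hx
      rcases mem_insert.1 ha with rfl | ha
      · exact hxa
      · exact absurd (hR x hx.1 a (hJR ha) hxa ▸ ha) hx.2
    intro x hx y hy hxy
    refine hR x (mem_sdiff.1 hx).1 y (mem_sdiff.1 hy).1 ?_
    rcases conn_insert_iff.1 hxy with hxy | ⟨⟨a, ha, hxa⟩, b, hb, hyb⟩
    · exact hxy
    · exact conn_trans (aux x hx a ha hxa) (conn_symm (aux y hy b hb hyb))
  · rintro ⟨⟨E, R⟩, v, J⟩ hx ⟨⟨E', R'⟩, w, K⟩ hy hxy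
    simp only [mem_sigma, mem_rootedForests, mem_filter, mem_powersetCard, mem_univ,
      true_and] at hx hy
    obtain ⟨⟨hE, hR, hk, hc⟩, ⟨hJR, hJ⟩, hv⟩ := hx
    obtain ⟨⟨hE', hR', hk', hc'⟩, ⟨hKR, hK⟩, hw⟩ := hy
    simp only [Sigma.mk.injEq, Prod.mk.injEq, heq_eq_eq] at hxy
    obtain ⟨⟨h1, h2⟩, h3⟩ := hxy
    have hnot : ∀ {E : Finset (Finset V)} {R J : Finset V} {v : V}, Indep E R → J ⊆ R → #J = j →
        (∀ x ∈ J, ¬ conn E v x) → insert v J ∉ E := by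
      intro E R J v hR hJR hJ hv he
      obtain ⟨a, ha⟩ := card_pos.1 (show 0 < #J by omega)
      exact hv a ha (conn_of_mem he (mem_insert_self _ _) (mem_insert_of_mem ha))
    have hEE : E = E' := by
      rw [← erase_insert (hnot hR hJR hJ hv), h1, h3, erase_insert (hnot hR' hKR hK hw)]
    subst hEE
    -- Otherwise `w` is one of the released roots in `J`. The root of `R'` in the component of `w`
    -- is not in `K`, so it lies in `R' \ K = R \ J`: a second root of `R` in that component.
    have hvw : v = w := by
      by_contra hne
      have hwJ : w ∈ J := by
        have : w ∈ insert v J := h3 ▸ mem_insert_self _ _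
        exact (mem_insert.1 this).resolve_left (Ne.symm hne)
      obtain ⟨r, hr, hwr⟩ := hR'.exists_conn (by omega) w
      have hrK : r ∈ R \ J := h2 ▸ mem_sdiff.2 ⟨hr, fun hrK => hw r hrK hwr⟩
      have := hR w (hJR hwJ) r (mem_sdiff.1 hrK).1 hwr
      exact (mem_sdiff.1 hrK).2 (this ▸ hwJ)
    subst hvw
    have hJK : J = K := by
      rw [← erase_insert (fun h => hv v h (conn_refl E v)), h3,
        erase_insert (fun h => hw v h (conn_refl E v))]
    subst hJK
    have hRR : R = R' := by rw [← sdiff_union_of_subset hJR, h2, sdiff_union_of_subset hKR]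
    subst hRR
    rfl
  · rintro ⟨⟨E, R⟩, e⟩ hx
    simp only [mem_sigma, mem_rootedForests, mem_filter] at hx
    obtain ⟨⟨hE, hR, hk, hc⟩, heE, hej⟩ := hx
    have hi := hE.indep_erase e heE
    have hne : e.Nonempty := card_pos.1 (by omega)
    have hcc := numComp_insert hne hi
    rw [insert_erase heE] at hcc
    -- A connection from `e` to its root, cut at its last passage through `e`, gives the vertex on
    -- the root's side.
    obtain ⟨v, hv, r₀, hr₀, hvr⟩ : ∃ v ∈ e, ∃ r ∈ R, conn (E.erase e) v r := by
      obtain ⟨x, hx⟩ := hne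
      obtain ⟨r, hr, hxr⟩ := hR.exists_conn (by omega) x
      rw [← insert_erase heE] at hxr
      rcases conn_insert_iff.1 hxr with hxr | ⟨-, b, hb, hrb⟩
      · exact ⟨x, hx, r, hr, hxr⟩
      · exact ⟨b, hb, r, hr, conn_symm hrb⟩
    have aux : ∀ r ∈ R, ∀ x ∈ e.erase v, ¬ conn (E.erase e) r x := by
      intro r hr x hx hrx
      rw [mem_erase] at hx
      have hrr : r = r₀ := hR r hr r₀ hr₀ (conn_trans (conn_mono (erase_subset _ _) hrx)
        (conn_trans (conn_of_mem heE hx.2 hv) (conn_mono (erase_subset _ _) hvr)))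
      subst hrr
      exact hx.1 (hi x hx.2 v hv (conn_trans (conn_symm hrx) (conn_symm hvr)))
    have hd : Disjoint R (e.erase v) := by
      rw [disjoint_left]
      exact fun x hx hxe => aux x hx x hxe (conn_refl _ x)
    have hcard : #(e.erase v) = j := by rw [card_erase_of_mem hv]; omega
    refine ⟨⟨(E.erase e, R ∪ e.erase v), v, e.erase v⟩, ?_, ?_⟩
    · simp only [mem_sigma, mem_rootedForests, mem_filter, mem_powersetCard, mem_univ, true_and]
      refine ⟨⟨hE.mono (erase_subset _ _), ?_, by rw [card_union_of_disjoint hd]; omega, by omega⟩,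
        ⟨subset_union_right, hcard⟩, fun x hx hvx => ?_⟩
      · intro x hx y hy hxy
        rcases mem_union.1 hx with hx | hx <;> rcases mem_union.1 hy with hy | hy
        · exact hR x hx y hy (conn_mono (erase_subset _ _) hxy)
        · exact absurd hxy (aux x hx y hy)
        · exact absurd (conn_symm hxy) (aux y hy x hx)
        · exact hi x (erase_subset _ _ hx) y (erase_subset _ _ hy) hxy
      · exact (mem_erase.1 hx).1 (hi v hv x (erase_subset _ _ hx) hvx).symm
    · simp [insert_erase hv, insert_erase heE, union_sdiff_cancel_right hd]

lemma Forest.card_eq {E : Finset (Finset V)} (hE : Forest E) :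
    Fintype.card V = numComp E + ∑ e ∈ E, (#e - 1) := by
  have := Forest.numComp_eq_add_sum (E := ∅) (G := E) (by simpa using hE) (by simp)
  rwa [numComp_empty, union_empty] at this

lemma card_rootedForests_zero_rec (k : ℕ) :
    Fintype.card V * #(rootedForests V k 0) = k * #(rootedForests V k 0) +
      Fintype.card V * ∑ j ∈ range (Fintype.card V + 1),
        j * ((k + j - 1).choose j * #(rootedForests V (k + j) 0)) := by
  have h : ∀ P ∈ rootedForests V k 0, Fintype.card V =
      k + ∑ j ∈ range (Fintype.card V + 1), j * #(P.1.filter fun e => #e = j + 1) := by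
    intro P hP
    rw [mem_rootedForests] at hP
    rw [← sum_card_sub_one]
    have := hP.1.card_eq
    omega
  have h1 : Fintype.card V * #(rootedForests V k 0) =
      ∑ P ∈ rootedForests V k 0, Fintype.card V := by
    rw [sum_const, smul_eq_mul, mul_comm]
  rw [h1, sum_congr rfl h, sum_add_distrib, sum_const, smul_eq_mul, mul_comm, sum_comm, mul_sum]
  congr 1
  refine sum_congr rfl fun j _ => ?_
  rw [← mul_sum]
  rcases Nat.eq_zero_or_pos j with rfl | hj
  · simp
  · rw [sum_card_edges k j hj]
    ring

lemma rootedForests_eq_empty {k m : ℕ} (h : Fintype.card V < k) :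
    rootedForests V k m = ∅ := by
  refine eq_empty_of_forall_notMem fun P hP => ?_
  have := (mem_rootedForests.1 hP).2.2.1
  have := card_le_univ P.2
  omega

lemma rootedForests_zero_zero [Nonempty V] : rootedForests V 0 0 = ∅ := by
  refine eq_empty_of_forall_notMem fun P hP => ?_
  obtain ⟨-, hR, hk, hc⟩ := mem_rootedForests.1 hP
  obtain ⟨r, hr, -⟩ := hR.exists_conn (by omega) (Classical.arbitrary V)
  rw [card_eq_zero] at hk
  simp [hk] at hr

/-- Initial value of the recursion: by Euler's formula, `n` components leave no room for an edge. -/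
lemma card_rootedForests_card_zero : #(rootedForests V (Fintype.card V) 0) = 1 := by
  rw [card_eq_one]
  refine ⟨(∅, univ), ?_⟩
  ext ⟨E, R⟩
  simp only [mem_rootedForests, mem_singleton, Prod.mk.injEq]
  constructor
  · rintro ⟨hE, -, hk, hc⟩
    refine ⟨eq_empty_of_forall_notMem fun e he => ?_, (card_eq_iff_eq_univ R).1 hk⟩
    have h1 := hE.card_eq
    have h2 := hE.two_le_card e he
    have h3 := single_le_sum (f := fun e : Finset V => #e - 1) (fun _ _ => Nat.zero_le _) he
    omega
  · rintro ⟨rfl, rfl⟩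
    exact ⟨forest_empty, fun x _ y _ h => conn_le (s := ⊥) (E := ∅) (by simp) h, card_univ,
      numComp_empty⟩

/-- A rooted tree is a tree together with a vertex. -/
lemma card_rootedForests_one_zero :
    #(rootedForests V 1 0) = Fintype.card V * #(rootedForests V 0 1) := by
  have h := sum_card_freeVerts (V := V) 0 0
  have h' : ∀ P ∈ rootedForests V 0 1, #(freeVerts P.1 P.2) = Fintype.card V := by
    intro P hP
    have hR := card_eq_zero.1 (mem_rootedForests.1 hP).2.2.1
    have : freeVerts P.1 P.2 = univ := eq_univ_of_forall fun v => mem_freeVerts.2 (by simp [hR])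
    rw [this, card_univ]
  rw [sum_congr rfl h', sum_const, smul_eq_mul] at h
  simp only [zero_add, one_mul] at h
  rw [← h, mul_comm]

end Counting

end EdgeFamily

/-! ### Stirling numbers, Bell polynomials and the power series of `forestCoeff` -/

/-- Combinatorially, `i` counts the elements outside the block of the extra point; the proof is an
induction with Pascal's rule. -/
lemma Nat.sum_choose_mul_stirlingSecond (m r : ℕ) :
    ∑ i ∈ range (m + 1), m.choose i * Nat.stirlingSecond i r =
      Nat.stirlingSecond (m + 1) (r + 1) := by
  induction m generalizing r with
  | zero => cases r <;> simp [Nat.stirlingSecond]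
  | succ m ih =>
    have h := sum_choose_succ_mul (R := ℕ) (fun i _ => Nat.stirlingSecond i r) m
    simp only [Nat.cast_id] at h
    rw [h, ih, Nat.stirlingSecond_succ_succ (m + 1) r]
    cases r with
    | zero => simp [Nat.stirlingSecond_succ_zero]
    | succ r =>
      simp only [Nat.stirlingSecond_succ_succ _ r, mul_add, sum_add_distrib, ih, mul_left_comm _ (r + 1),
        ← mul_sum]
      ring

lemma bellPolynomial_eval (m : ℕ) (x : ℚ) :
    (bellPolynomial m).eval x = ∑ r ∈ range (m + 1), (Nat.stirlingSecond m r : ℚ) * x ^ r := by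
  simp [bellPolynomial, Polynomial.eval_finsetSum]

lemma bellPolynomial_eval_of_le {m N : ℕ} (h : m ≤ N) (x : ℚ) :
    (bellPolynomial m).eval x = ∑ r ∈ range (N + 1), (Nat.stirlingSecond m r : ℚ) * x ^ r := by
  rw [bellPolynomial_eval]
  refine sum_subset (range_mono (by omega)) fun r _ hr => ?_
  rw [mem_range] at hr
  rw [Nat.stirlingSecond_eq_zero_of_lt (by omega)]
  simp

lemma bellPolynomial_succ_eval (m : ℕ) (x : ℚ) :
    (bellPolynomial (m + 1)).eval x =
      x * ∑ i ∈ range (m + 1), (m.choose i : ℚ) * (bellPolynomial i).eval x := by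
  rw [sum_congr rfl fun i hi => by
    rw [bellPolynomial_eval_of_le (show i ≤ m by have := mem_range.1 hi; omega)]]
  simp only [mul_sum]
  rw [sum_comm, bellPolynomial_eval, sum_range_succ', Nat.stirlingSecond_succ_zero]
  simp only [Nat.cast_zero, zero_mul, add_zero]
  refine sum_congr rfl fun r _ => ?_
  rw [← Nat.sum_choose_mul_stirlingSecond, Nat.cast_sum, sum_mul]
  refine sum_congr rfl fun i _ => ?_
  push_cast
  ring

/-- The Bell recursion with the binomial coefficient absorbed, in the form that the recursion for
fully rooted forests takes. -/
lemma mul_bellPolynomial_eval (m : ℕ) (x : ℚ) :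
    m * (bellPolynomial m).eval x =
      x * ∑ j ∈ range (m + 1), j * ((m.choose j : ℚ) * (bellPolynomial (m - j)).eval x) := by
  cases m with
  | zero => simp
  | succ m =>
    rw [bellPolynomial_succ_eval, sum_range_succ' _ (m + 1),
      ← sum_range_reflect (fun i => (m.choose i : ℚ) * (bellPolynomial i).eval x)]
    simp only [Nat.cast_zero, zero_mul, add_zero]
    rw [mul_left_comm, mul_sum]
    congr 1
    refine sum_congr rfl fun j hj => ?_
    have hj' := mem_range.1 hj
    have h1 : m + 1 - 1 - j = m - j := by omega
    have h2 : m + 1 - (j + 1) = m - j := by omega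
    have h3 := Nat.add_one_mul_choose_eq m j
    have h3' : ((m : ℚ) + 1) * m.choose j = (m + 1).choose (j + 1) * (j + 1) := by exact_mod_cast h3
    rw [h1, h2, Nat.choose_symm (by omega), ← mul_assoc, ← mul_assoc]
    push_cast
    rw [h3']
    ring

/-- Compare the two expansions of `S(s + 1, p + 1)`; the term `i = s` cancels. -/
lemma Nat.succ_mul_stirlingSecond (s p : ℕ) :
    (p + 1) * Nat.stirlingSecond s (p + 1) =
      ∑ i ∈ range s, s.choose i * Nat.stirlingSecond i p := by
  have h := Nat.sum_choose_mul_stirlingSecond s p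
  rw [sum_range_succ, Nat.stirlingSecond_succ_succ] at h
  simp at h
  omega

open PowerSeries in
lemma coeff_exp_sub_one_pow (p s : ℕ) :
    coeff (R := ℚ) s ((exp ℚ - 1) ^ p) = p.factorial * Nat.stirlingSecond s p / s.factorial := by
  induction p generalizing s with
  | zero => cases s <;> simp [Nat.stirlingSecond, coeff_one]
  | succ p ih =>
    rw [pow_succ, coeff_mul, Nat.sum_antidiagonal_eq_sum_range_succ_mk, sum_range_succ]
    have h0 : coeff (s - s) (exp ℚ - 1) = 0 := by simp
    rw [h0, mul_zero, add_zero]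
    have h : (p + 1 : ℚ) * Nat.stirlingSecond s (p + 1) =
      ∑ i ∈ range s, s.choose i * Nat.stirlingSecond i p := by
      exact_mod_cast Nat.succ_mul_stirlingSecond s p
    rw [Nat.factorial_succ]
    push_cast
    rw [mul_comm (p + 1 : ℚ), mul_assoc, h, Nat.cast_sum, mul_sum, sum_div]
    refine sum_congr rfl fun i hi => ?_
    have hi' := mem_range.1 hi
    rw [ih, map_sub, coeff_exp, coeff_one, if_neg (by omega), Nat.cast_mul, Nat.cast_choose ℚ hi'.le]
    have := Nat.factorial_ne_zero s
    have := Nat.factorial_ne_zero i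
    have := Nat.factorial_ne_zero (s - i)
    simp
    field_simp

/-- `forestCoeff s p` is `s!` times the coefficient of `t ^ s` in `((1 - t) (exp t - 1)) ^ p / p!`. -/
def forestCoeff (s p : ℕ) : ℚ :=
  ∑ q ∈ range (s + 1 - p), (-1 : ℚ) ^ (s - p - q) * (p.choose (s - p - q) : ℚ) *
    (Nat.stirlingSecond (p + q) p : ℚ) * ((s.factorial : ℚ) / ((p + q).factorial : ℚ))

lemma coeff_one_sub_X_pow (p j : ℕ) :
    PowerSeries.coeff j ((1 - PowerSeries.X : PowerSeries ℚ) ^ p) = (-1) ^ j * p.choose j := by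
  have h : (1 - PowerSeries.X : PowerSeries ℚ) ^ p =
      (((1 - Polynomial.X) ^ p : Polynomial ℚ) : PowerSeries ℚ) := by
    push_cast
    rfl
  rw [h, Polynomial.coeff_coe]
  have h2 : (1 - Polynomial.X : Polynomial ℚ) ^ p =
      ((1 + Polynomial.X) ^ p : Polynomial ℚ).comp (Polynomial.C (-1) * Polynomial.X) := by
    simp [sub_eq_add_neg]
  rw [h2, Polynomial.comp_C_mul_X_coeff, Polynomial.coeff_one_add_X_pow]
  ring

open PowerSeries in
lemma coeff_forestSeries_pow (s p : ℕ) :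
    coeff s (((1 - X) * (exp ℚ - 1)) ^ p) = p.factorial / s.factorial * forestCoeff s p := by
  rw [mul_pow, mul_comm, coeff_mul, Nat.sum_antidiagonal_eq_sum_range_succ_mk, forestCoeff, mul_sum]
  have hs := Nat.factorial_ne_zero s
  rcases Nat.lt_or_ge s p with h | h
  · have : s + 1 - p = 0 := by omega
    rw [this, range_zero, sum_empty]
    refine sum_eq_zero fun i hi => ?_
    rw [coeff_exp_sub_one_pow, Nat.stirlingSecond_eq_zero_of_lt (by have := mem_range.1 hi; omega)]
    simp
  · obtain ⟨d, rfl⟩ := Nat.exists_eq_add_of_le h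
    -- The indices below `p` contribute nothing since `S(i, p) = 0` there; the others are written `i
    -- = p + q`.
    rw [show (p + d).succ = p + (d + 1) by omega, sum_range_add, sum_eq_zero, zero_add,
      show p + d + 1 - p = d + 1 by omega]
    · refine sum_congr rfl fun q _ => ?_
      rw [coeff_exp_sub_one_pow, coeff_one_sub_X_pow, show p + d - (p + q) = p + d - p - q by omega]
      field_simp
    · intro i hi
      rw [coeff_exp_sub_one_pow, Nat.stirlingSecond_eq_zero_of_lt (mem_range.1 hi)]
      simp

open PowerSeries in
-- Identifies `(1 - t)(exp t - 1)` as the exponential series of the weights in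
-- `succ_mul_card_rootedForests`.
lemma coeff_forestSeries (l : ℕ) :
    coeff (l + 1) ((1 - X) * (exp ℚ - 1)) =
      ((if l = 0 then 1 else 0) - (l : ℚ)) / (l + 1).factorial := by
  rw [sub_mul, one_mul, map_sub, coeff_succ_X_mul, map_sub, map_sub, coeff_exp, coeff_exp,
    coeff_one, coeff_one, if_neg (Nat.succ_ne_zero l), Nat.factorial_succ]
  have := Nat.factorial_ne_zero l
  rcases Nat.eq_zero_or_pos l with rfl | hl
  · simp
  · have h : l ≠ 0 := by omega
    simp only [h, if_false]
    push_cast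
    simp
    field_simp
    ring

lemma forestCoeff_zero (s : ℕ) : forestCoeff s 0 = if s = 0 then 1 else 0 := by
  have h := coeff_forestSeries_pow s 0
  have hs := Nat.factorial_ne_zero s
  rw [pow_zero, PowerSeries.coeff_one] at h
  rcases Nat.eq_zero_or_pos s with rfl | h'
  · simpa using h.symm
  · have hs0 : s ≠ 0 := by omega
    simp [hs0, hs] at h ⊢
    exact h

/-- Splits one factor off the power `p + 1` of the series; its constant coefficient is zero, so the
index starts at `l + 1`. -/
lemma succ_mul_forestCoeff (s p : ℕ) :
    (p + 1) * forestCoeff s (p + 1) = ∑ l ∈ range s, ((if l = 0 then 1 else 0) - (l : ℚ)) *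
      (s.choose (l + 1) * forestCoeff (s - (l + 1)) p) := by
  have h := coeff_forestSeries_pow s (p + 1)
  rw [pow_succ', PowerSeries.coeff_mul, Nat.sum_antidiagonal_eq_sum_range_succ_mk,
    sum_range_succ'] at h
  have h0 : PowerSeries.coeff 0 ((1 - PowerSeries.X) * (PowerSeries.exp ℚ - 1)) = 0 := by simp
  rw [h0, zero_mul, add_zero] at h
  have hs := Nat.factorial_ne_zero s
  have hp := Nat.factorial_ne_zero p
  rw [Nat.factorial_succ] at h
  push_cast at h
  have h2 : (p + 1) * forestCoeff s (p + 1) = s.factorial / p.factorial *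
      ((p + 1) * p.factorial / s.factorial * forestCoeff s (p + 1)) := by
    field_simp
  rw [h2, ← h, mul_sum]
  refine sum_congr rfl fun l hl => ?_
  have hl' := mem_range.1 hl
  rw [coeff_forestSeries, coeff_forestSeries_pow, Nat.cast_choose ℚ (show l + 1 ≤ s by omega)]
  have := Nat.factorial_ne_zero (l + 1)
  have := Nat.factorial_ne_zero (s - (l + 1))
  field_simp

namespace EdgeFamily

/-! ### Walks and cycles of hypergraphs versus edge families -/

section Bridge

variable {V : Type*}

/-- The graph in which two distinct vertices are adjacent if they lie in a common edge. -/
def graph (E : Finset (Finset V)) : SimpleGraph V where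
  Adj x y := x ≠ y ∧ ∃ e ∈ E, x ∈ e ∧ y ∈ e
  symm := ⟨fun _ _ ⟨h, e, he, hx, hy⟩ => ⟨h.symm, e, he, hy, hx⟩⟩
  loopless := ⟨fun _ h => h.1 rfl⟩

lemma reachable_of_conn {E : Finset (Finset V)} {x y : V} (h : conn E x y) :
    (graph E).Reachable x y := by
  refine conn_le (s := (graph E).reachableSetoid) (fun e he x hx y hy => ?_) h
  by_cases hxy : x = y
  · subst hxy
    exact SimpleGraph.Reachable.refl x
  · exact SimpleGraph.Adj.reachable (G := graph E) ⟨hxy, e, he, hx, hy⟩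

/-- A shortest chain of edges between two vertices of a component has distinct vertices and
distinct edges. -/
lemma exists_chain {E : Finset (Finset V)} {x y : V} (h : conn E x y) :
    ∃ (k : ℕ) (v : ℕ → V) (ε : ℕ → Finset V), v 0 = x ∧ v k = y ∧
      (∀ i < k, ε i ∈ E ∧ v i ∈ ε i ∧ v (i + 1) ∈ ε i) ∧
      Set.InjOn v (Set.Iic k) ∧ Set.InjOn ε (Set.Iio k) := by
  have hr := reachable_of_conn h
  obtain ⟨w, hw⟩ := hr.exists_walk_length_eq_dist
  -- Along a shortest walk the distance from `x` is the index, so vertices cannot repeat. A repeated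
  -- edge would make `v i` and `v (j + 1)` adjacent with `i < j`, a shortcut.
  have hd : ∀ i ≤ w.length, (graph E).dist x (w.getVert i) = i := by
    intro i hi
    have h1 := SimpleGraph.dist_le (w.take i)
    have h2 := SimpleGraph.dist_le (w.drop i)
    have h3 := (w.take i).reachable.dist_triangle_left y
    rw [SimpleGraph.Walk.take_length] at h1
    rw [SimpleGraph.Walk.drop_length] at h2
    omega
  have hadj : ∀ i, ∃ e : Finset V, i < w.length → e ∈ E ∧ w.getVert i ∈ e ∧
      w.getVert (i + 1) ∈ e := by
    intro i
    by_cases hi : i < w.length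
    · obtain ⟨-, e, he⟩ := w.adj_getVert_succ hi
      exact ⟨e, fun _ => he⟩
    · exact ⟨∅, fun h => absurd h hi⟩
  choose ε hε using hadj
  have hstep : ∀ i j, i < j → j < w.length → ε i ≠ ε j := by
    intro i j hij hj heq
    have h1 := hε i (by omega)
    have h2 := hε j hj
    have hne : w.getVert i ≠ w.getVert (j + 1) := by
      intro h
      have := hd i (by omega)
      rw [h, hd (j + 1) hj] at this
      omega
    have ha : (graph E).Adj (w.getVert i) (w.getVert (j + 1)) :=
      ⟨hne, ε i, h1.1, h1.2.1, heq ▸ h2.2.2⟩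
    have h3 := (w.take i).reachable.dist_triangle_left (w.getVert (j + 1))
    have h4 := SimpleGraph.dist_eq_one_iff_adj.2 ha
    rw [hd i (by omega), hd (j + 1) hj, h4] at h3
    omega
  refine ⟨w.length, w.getVert, ε, w.getVert_zero, w.getVert_length, hε, ?_, ?_⟩
  · intro i hi j hj hij
    rw [← hd i hi, hij, hd j hj]
  · intro i hi j hj hij
    by_contra hne
    rcases Nat.lt_or_gt_of_ne hne with h | h
    · exact hstep i j h hj hij
    · exact hstep j i h hi hij.symm

variable [DecidableEq V]

/-- The hypergraph with vertex set `V` and edges `E`. -/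
def toHypergraph (E : Finset (Finset V)) : Hypergraph V where
  vertexSet := Set.univ
  edgeSet := {A | ∃ e ∈ E, (e : Set V) = A}
  subset_vertexSet_of_mem_edgeSet' := fun _ _ => Set.subset_univ _

omit [DecidableEq V] in
lemma toHypergraph_injective : Function.Injective (toHypergraph (V := V)) := by
  intro E F h
  have h' : (toHypergraph E).edgeSet = (toHypergraph F).edgeSet := by rw [h]
  ext e
  have := Set.ext_iff.1 h' (e : Set V)
  simpa [toHypergraph] using this

omit [DecidableEq V] in
lemma joined_iff {E : Finset (Finset V)} {x y : V} :
    (toHypergraph E).Joined x y ↔ conn E x y := by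
  constructor
  · rintro ⟨w, rfl, rfl⟩
    suffices h : ∀ i, conn E (w.vert 0) (w.vert i) from h _
    intro i
    induction i using Fin.induction with
    | zero => exact conn_refl E _
    | succ i ih =>
      obtain ⟨e, he, hei⟩ := w.edge_mem i
      refine conn_trans ih (conn_of_mem he ?_ ?_)
      · exact Finset.mem_coe.1 (hei ▸ w.left_mem i)
      · exact Finset.mem_coe.1 (hei ▸ w.right_mem i)
  · intro h
    obtain ⟨k, v, ε, h0, hk, hε, -, -⟩ := exists_chain h
    exact ⟨⟨k, fun i => v i, fun i => ε i, fun _ => Set.mem_univ _,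
      fun i => ⟨ε i, (hε i i.2).1, rfl⟩, fun i => (hε i i.2).2.1, fun i => (hε i i.2).2.2⟩, h0, hk⟩

lemma forest_of_isHyperforest {E : Finset (Finset V)} (h2 : ∀ e ∈ E, 2 ≤ #e)
    (h : (toHypergraph E).IsHyperforest) : Forest E := by
  refine ⟨h2, fun e he x hx y hy hxy => ?_⟩
  by_contra hne
  obtain ⟨k, v, ε, h0, hk, hε, hv, hεi⟩ := exists_chain hxy
  have hk0 : 0 < k := by
    rcases Nat.eq_zero_or_pos k with rfl | hk0
    · exact absurd (h0.symm.trans hk) hne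
    · exact hk0
  -- The chain from `x` to `y` avoids `e`; closing it up by `e`, with `x` again as last vertex,
  -- gives a cycle.
  let w : (toHypergraph E).Walk :=
    { length := k + 1
      vert := fun i => if (i : ℕ) ≤ k then v i else x
      edge := fun i => if (i : ℕ) < k then ε i else e
      vert_mem := fun _ => Set.mem_univ _
      edge_mem := by
        intro i
        by_cases hi : (i : ℕ) < k
        · exact ⟨ε i, (mem_erase.1 (hε i hi).1).2, by simp [hi]⟩
        · exact ⟨e, he, by simp [hi]⟩
      left_mem := by
        intro i
        have hi1 : (i : ℕ) ≤ k := by omega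
        by_cases hi : (i : ℕ) < k
        · simpa [hi, hi1] using (hε i hi).2.1
        · have hik : (i : ℕ) = k := by omega
          simpa [hik, hk] using hy
      right_mem := by
        intro i
        by_cases hi : (i : ℕ) < k
        · have hi1 : (i : ℕ) + 1 ≤ k := by omega
          simpa [hi, hi1] using (hε i hi).2.2
        · have hik : (i : ℕ) = k := by omega
          simpa [hik] using hx }
  refine h w ⟨by simp only [w]; omega, ?_, ?_, ?_⟩
  · simp [w, h0]
  · intro i j hij
    have hi : (i : ℕ) ≤ k := Nat.lt_succ_iff.1 i.2
    have hj : (j : ℕ) ≤ k := Nat.lt_succ_iff.1 j.2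
    simp only [w, Fin.val_castSucc, hi, hj, if_true] at hij
    exact Fin.ext (hv hi hj hij)
  · intro i j hij
    have hi : (i : ℕ) ≤ k := Nat.lt_succ_iff.1 i.2
    have hj : (j : ℕ) ≤ k := Nat.lt_succ_iff.1 j.2
    have hεe : ∀ i < k, (ε i : Set V) ≠ e := fun i hi h =>
      (mem_erase.1 (hε i hi).1).1 (Finset.coe_injective h)
    simp only [w] at hij
    apply Fin.ext
    split_ifs at hij with h1 h2 h2
    · exact hεi h1 h2 (Finset.coe_injective hij)
    · exact absurd hij (hεe _ h1)
    · exact absurd hij.symm (hεe _ h2)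
    · omega

/-- The rest of a cycle joins the two ends of its first edge without using that edge, so these ends
would be equal. -/
lemma Forest.isHyperforest {E : Finset (Finset V)} (h : Forest E) :
    (toHypergraph E).IsHyperforest := by
  rintro ⟨k, v, ε, hv, hε, hl, hr⟩ ⟨hk, hclosed, hvi, hεi⟩
  dsimp only at hk hclosed hvi hεi
  obtain ⟨k, rfl⟩ := Nat.exists_eq_add_of_le' hk
  obtain ⟨e, he, he0⟩ := hε 0
  have hconn : ∀ i : Fin (k + 2), conn (E.erase e) (v 1) (v i.succ) := by
    intro i
    induction i using Fin.induction with
    | zero => exact conn_refl _ _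
    | succ i ih =>
      obtain ⟨f, hf, hfi⟩ := hε i.succ
      have hfe : f ≠ e := by
        rintro rfl
        exact Fin.succ_ne_zero i (hεi (hfi.symm.trans he0))
      refine conn_trans ih (conn_of_mem (mem_erase.2 ⟨hfe, hf⟩) ?_ ?_)
      · exact Finset.mem_coe.1 (hfi ▸ hl i.succ)
      · exact Finset.mem_coe.1 (hfi ▸ hr i.succ)
  have h1 := hconn (Fin.last _)
  rw [Fin.succ_last, hclosed] at h1
  have hv1 : v 1 ∈ e := Finset.mem_coe.1 (he0 ▸ hr 0)
  have hv0 : v 0 ∈ e := Finset.mem_coe.1 (he0 ▸ hl 0)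
  have h10 := h.indep_erase e he _ hv1 _ hv0 h1
  have := @hvi 1 0 h10
  simp at this

omit [DecidableEq V] in
lemma numComponents_eq [Fintype V] (E : Finset (Finset V)) :
    (toHypergraph E).numComponents = numComp E := by
  have h : (toHypergraph E).componentVertexSets = (conn E).classes := by
    ext C
    simp only [Hypergraph.componentVertexSets, Setoid.classes, Set.mem_ofPred_eq]
    constructor
    · rintro ⟨x, -, rfl⟩
      exact ⟨x, by ext y; exact joined_iff.trans ⟨conn_symm, conn_symm⟩⟩
    · rintro ⟨x, rfl⟩
      exact ⟨x, Set.mem_univ _, by ext y; exact Iff.trans ⟨conn_symm, conn_symm⟩ joined_iff.symm⟩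
  rw [Hypergraph.numComponents, h, ← Nat.card_coe_set_eq, numComp]
  exact (Nat.card_congr (Setoid.quotientEquivClasses _)).symm

omit [DecidableEq V] in
lemma isSpanningSub_iff [Fintype V] {H : Hypergraph V} :
    H.IsSpanningSub (Hypergraph.completeAtLeastTwo V) ↔
      ∃ E : Finset (Finset V), (∀ e ∈ E, 2 ≤ #e) ∧ toHypergraph E = H := by
  classical
  constructor
  · rintro ⟨hV, hE⟩
    refine ⟨univ.filter fun e : Finset V => (e : Set V) ∈ H.edgeSet, fun e he => ?_, ?_⟩
    · have := hE (mem_filter.1 he).2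
      simpa [Hypergraph.completeAtLeastTwo] using this
    · ext A
      · rw [hV]; rfl
      · simp only [toHypergraph, mem_filter, mem_univ, true_and, Set.mem_ofPred_eq]
        constructor
        · rintro ⟨e, he, rfl⟩
          exact he
        · intro hA
          exact ⟨A.toFinset, by simpa using hA, by simp⟩
  · rintro ⟨E, h2, rfl⟩
    refine ⟨rfl, ?_⟩
    rintro A ⟨e, he, rfl⟩
    simpa [Hypergraph.completeAtLeastTwo] using h2 e he

lemma numSpanningHyperforests_eq [Fintype V] (p : ℕ) :
    (Hypergraph.completeAtLeastTwo V).numSpanningHyperforests p = #(rootedForests V 0 p) := by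
  have h : {F : Hypergraph V | F.IsSpanningSub (Hypergraph.completeAtLeastTwo V) ∧
      F.IsHyperforest ∧ F.numComponents = p} =
      (fun P : Finset (Finset V) × Finset V => toHypergraph P.1) '' (rootedForests V 0 p) := by
    ext F
    simp only [Set.mem_ofPred_eq, Set.mem_image, mem_coe, mem_rootedForests, isSpanningSub_iff]
    constructor
    · rintro ⟨⟨E, h2, rfl⟩, hF, hp⟩
      rw [numComponents_eq] at hp
      exact ⟨(E, ∅), ⟨forest_of_isHyperforest h2 hF, by simp [Indep], rfl, by simpa using hp⟩, rfl⟩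
    · rintro ⟨⟨E, R⟩, ⟨hE, -, -, hp⟩, rfl⟩
      exact ⟨⟨E, hE.two_le_card, rfl⟩, hE.isHyperforest, by rw [numComponents_eq]; simpa using hp⟩
  rw [Hypergraph.numSpanningHyperforests, h, Set.InjOn.ncard_image, Set.ncard_coe_finset]
  rintro ⟨E, R⟩ hP ⟨F, S⟩ hQ hPQ
  have hR := card_eq_zero.1 (mem_rootedForests.1 (mem_coe.1 hP)).2.2.1
  have hS := card_eq_zero.1 (mem_rootedForests.1 (mem_coe.1 hQ)).2.2.1
  exact Prod.ext (toHypergraph_injective hPQ) (hR.trans hS.symm)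

omit [DecidableEq V] in
lemma numComponents_eq_one_iff [Fintype V] [Nonempty V] (E : Finset (Finset V)) :
    (toHypergraph E).numComponents = 1 ↔ (toHypergraph E).IsConnected := by
  rw [numComponents_eq, numComp, Nat.card_eq_one_iff_unique]
  constructor
  · rintro ⟨h, -⟩ x - y -
    exact joined_iff.2 (Quotient.exact (Subsingleton.elim _ _))
  · intro h
    refine ⟨⟨fun a b => ?_⟩, ⟨Quotient.mk _ (Classical.arbitrary V)⟩⟩
    induction a using Quotient.inductionOn
    induction b using Quotient.inductionOn
    exact Quotient.sound (joined_iff.1 (h _ (Set.mem_univ _) _ (Set.mem_univ _)))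

lemma numSpanningHypertrees_eq [Fintype V] [Nonempty V] :
    (Hypergraph.completeAtLeastTwo V).numSpanningHypertrees =
      (Hypergraph.completeAtLeastTwo V).numSpanningHyperforests 1 := by
  rw [Hypergraph.numSpanningHypertrees, Hypergraph.numSpanningHyperforests]
  congr 1
  ext F
  refine and_congr_right fun hF => ?_
  obtain ⟨E, -, rfl⟩ := isSpanningSub_iff.1 hF
  rw [numComponents_eq_one_iff, Hypergraph.IsHypertree, and_comm]

omit [DecidableEq V] in
lemma numRootedSpanningHypertrees_eq [Fintype V] :
    (Hypergraph.completeAtLeastTwo V).numRootedSpanningHypertrees =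
      (Hypergraph.completeAtLeastTwo V).numSpanningHypertrees * Fintype.card V := by
  have h : {T : Hypergraph V × V | T.1.IsSpanningSub (Hypergraph.completeAtLeastTwo V) ∧
      T.1.IsHypertree ∧ T.2 ∈ T.1.vertexSet} =
      {T : Hypergraph V | T.IsSpanningSub (Hypergraph.completeAtLeastTwo V) ∧ T.IsHypertree} ×ˢ
        (Set.univ : Set V) := by
    ext ⟨T, v⟩
    simp only [Set.mem_ofPred_eq, Set.mem_prod, Set.mem_univ, and_true]
    constructor
    · rintro ⟨h1, h2, -⟩
      exact ⟨h1, h2⟩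
    · rintro ⟨h1, h2⟩
      exact ⟨h1, h2, by rw [h1.1]; trivial⟩
  rw [Hypergraph.numRootedSpanningHypertrees, h, Set.ncard_prod, Set.ncard_univ,
    Nat.card_eq_fintype_card, Hypergraph.numSpanningHypertrees]

end Bridge

/-! ### Solving the two recursions -/

section Solution

variable {V : Type*} [DecidableEq V] [Fintype V]

/-- Strong induction on the number `d` of vertices that are not roots: the term `j = 0` has weight
zero, so the recursion only involves `d - j` with `j ≥ 1`. Subtracting `(n - d)` times the unknown
leaves the factor `d`, which is cancelled. -/
lemma card_rootedForests_zero_sub (d : ℕ) (hd : d < Fintype.card V) :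
    (#(rootedForests V (Fintype.card V - d) 0) : ℚ) =
      ((Fintype.card V - 1).choose (Fintype.card V - d - 1) : ℚ) *
        (bellPolynomial d).eval (Fintype.card V : ℚ) := by
  set n := Fintype.card V with hn
  induction d using Nat.strong_induction_on with
  | _ d ih =>
    rcases Nat.eq_zero_or_pos d with rfl | hd0
    · rw [Nat.sub_zero, hn, card_rootedForests_card_zero, bellPolynomial_eval]
      simp
    · have hrec := card_rootedForests_zero_rec (V := V) (n - d)
      rw [← hn] at hrec
      have hrec' : (n : ℚ) * #(rootedForests V (n - d) 0) =
          (n - d : ℕ) * #(rootedForests V (n - d) 0) +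
          n * ∑ j ∈ range (n + 1), j * (((n - d + j - 1).choose j : ℚ) *
            #(rootedForests V (n - d + j) 0)) := by
        exact_mod_cast hrec
      have hsum : ∑ j ∈ range (n + 1), (j : ℚ) * (((n - d + j - 1).choose j : ℚ) *
            #(rootedForests V (n - d + j) 0)) =
          ((n - 1).choose (n - d - 1) : ℚ) *
            ∑ j ∈ range (d + 1), j * ((d.choose j : ℚ) * (bellPolynomial (d - j)).eval (n : ℚ)) := by
        rw [← sum_subset (range_mono (show d + 1 ≤ n + 1 by omega)), mul_sum]
        · refine sum_congr rfl fun j hj => ?_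
          have hj' := mem_range.1 hj
          rcases Nat.eq_zero_or_pos j with rfl | hj0
          · simp
          · have h1 : n - d + j = n - (d - j) := by omega
            have h2 := ih (d - j) (by omega) (by omega)
            -- Trinomial revision takes the binomial coefficient that does not depend on `j` out of
            -- the sum.
            have h3 := Nat.choose_mul (n := n - 1) (k := n - d + j - 1) (s := n - d - 1)
              (by omega)
            have h4 : (n - d + j - 1).choose (n - d - 1) = (n - d + j - 1).choose j := by
              rw [← Nat.choose_symm (by omega)]
              congr 1
              omega
            rw [h4, show n - 1 - (n - d - 1) = d by omega,
              show n - d + j - 1 - (n - d - 1) = j by omega] at h3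
            have h3' : ((n - 1).choose (n - d + j - 1) : ℚ) * (n - d + j - 1).choose j =
              (n - 1).choose (n - d - 1) * d.choose j := by exact_mod_cast h3
            rw [← h1] at h2
            rw [h2]
            linear_combination (j : ℚ) * (bellPolynomial (d - j)).eval (n : ℚ) * h3'
        · intro j _ hj
          rw [mem_range] at hj
          rw [rootedForests_eq_empty (by omega)]
          simp
      rw [hsum, mul_left_comm, ← mul_bellPolynomial_eval, Nat.cast_sub hd.le] at hrec'
      have hdq : (d : ℚ) ≠ 0 := by exact_mod_cast hd0.ne'
      apply mul_left_cancel₀ hdq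
      linear_combination hrec'

lemma card_rootedForests_zero {s : ℕ} (hs : s ∈ Icc 1 (Fintype.card V)) :
    (#(rootedForests V s 0) : ℚ) = ((Fintype.card V - 1).choose (s - 1) : ℚ) *
      (bellPolynomial (Fintype.card V - s)).eval (Fintype.card V : ℚ) := by
  rw [mem_Icc] at hs
  have h := card_rootedForests_zero_sub (V := V) (Fintype.card V - s) (by omega)
  rwa [Nat.sub_sub_self hs.2] at h

lemma succ_mul_card_rootedForests (k m : ℕ) :
    ((m : ℚ) + 1) * #(rootedForests V k (m + 1)) =
      ∑ l ∈ range (Fintype.card V + 1), ((if l = 0 then 1 else 0) - (l : ℚ)) *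
        (((k + (l + 1)).choose (l + 1) : ℚ) * #(rootedForests V (k + (l + 1)) m)) := by
  have h := card_rootedForests_succ (V := V) k m
  have h' : ((m : ℚ) + 1) * #(rootedForests V k (m + 1)) + ∑ l ∈ range (Fintype.card V + 1),
      (l : ℚ) * (((k + (l + 1)).choose (l + 1) : ℚ) * #(rootedForests V (k + (l + 1)) m)) =
      (k + 1) * #(rootedForests V (k + 1) m) := by exact_mod_cast h
  simp only [sub_mul, sum_sub_distrib, ite_mul, one_mul, zero_mul, sum_ite_eq', mem_range]
  rw [if_pos (by omega), eq_sub_iff_add_eq, h']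
  simp

/-- The coefficient of `x ^ k` in `A_m = φ(D) ^ m / m! A_0`. The induction on `m` compares the
recursion for rooted forests with `succ_mul_forestCoeff`. -/
lemma card_rootedForests (k m : ℕ) :
    (#(rootedForests V k m) : ℚ) = ∑ s ∈ range (Fintype.card V + 1),
      ((k + s).choose k : ℚ) * #(rootedForests V (k + s) 0) * forestCoeff s m := by
  induction m generalizing k with
  | zero => simp [forestCoeff_zero]
  | succ m ih =>
    have hm : ((m : ℚ) + 1) ≠ 0 := by positivity
    apply mul_left_cancel₀ hm
    set n := Fintype.card V with hn
    have hvan : ∀ {t : ℕ}, n < t → #(rootedForests V t 0) = 0 := by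
      intro t ht
      rw [rootedForests_eq_empty ht, card_empty]
    let F : ℕ → ℕ → ℚ := fun l s => ((if l = 0 then 1 else 0) - (l : ℚ)) *
      (((k + (l + 1)).choose (l + 1) : ℚ) * (((k + (l + 1) + s).choose (k + (l + 1)) : ℚ) *
        #(rootedForests V (k + (l + 1) + s) 0) * forestCoeff s m))
    have hL : ((m : ℚ) + 1) * #(rootedForests V k (m + 1)) =
        ∑ l ∈ range n, ∑ s ∈ range (n - l), F l s := by
      rw [succ_mul_card_rootedForests, ← hn, sum_range_succ,
        rootedForests_eq_empty (k := k + (n + 1)) (by omega), card_empty]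
      simp only [Nat.cast_zero, mul_zero, add_zero]
      refine sum_congr rfl fun l _ => ?_
      rw [ih, ← sum_subset (range_mono (show n - l ≤ n + 1 by omega)), mul_sum, mul_sum]
      intro s _ hs
      rw [mem_range] at hs
      rw [hvan (by omega)]
      simp
    -- The double sum is regrouped by `t = l + s`, so that `k + (t + 1)` roots occur; on the other
    -- side the index `0` is split off, where `forestCoeff 0 (m + 1)` vanishes.
    rw [hL, ← sum_range_diag_flip n F, sum_range_succ' _ n, mul_add, mul_sum]
    have h0 : ((m : ℚ) + 1) * (((k + 0).choose k : ℚ) * #(rootedForests V (k + 0) 0) *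
        forestCoeff 0 (m + 1)) = 0 := by
      simp [forestCoeff]
    rw [h0, add_zero]
    refine sum_congr rfl fun t _ => ?_
    rw [mul_left_comm, succ_mul_forestCoeff, mul_sum]
    refine sum_congr rfl fun l hl => ?_
    have hl' := mem_range.1 hl
    have h1 : k + (l + 1) + (t - l) = k + (t + 1) := by omega
    have h2 := Nat.choose_mul (n := k + (t + 1)) (k := k + (l + 1)) (s := k) (by omega)
    have h3 : (k + (l + 1)).choose k = (k + (l + 1)).choose (l + 1) := by
      rw [← Nat.choose_symm (by omega)]
      congr 1
      omega
    rw [h3, Nat.add_sub_cancel_left, Nat.add_sub_cancel_left] at h2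
    have h2' : ((k + (t + 1)).choose (k + (l + 1)) : ℚ) * (k + (l + 1)).choose (l + 1) =
      (k + (t + 1)).choose k * (t + 1).choose (l + 1) := by exact_mod_cast h2
    simp only [F]
    rw [h1, Nat.add_sub_add_right]
    linear_combination ((if l = 0 then 1 else 0) - (l : ℚ)) *
      #(rootedForests V (k + (t + 1)) 0) * forestCoeff (t - l) m * h2'

lemma card_rootedForests_zero_left [Nonempty V] (p : ℕ) :
    (#(rootedForests V 0 p) : ℚ) = ∑ s ∈ Icc 1 (Fintype.card V),
      ((Fintype.card V - 1).choose (s - 1) : ℚ) *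
        (bellPolynomial (Fintype.card V - s)).eval (Fintype.card V : ℚ) * forestCoeff s p := by
  have h : Icc 1 (Fintype.card V) ⊆ range (Fintype.card V + 1) := fun s hs => by
    rw [mem_Icc] at hs
    rw [mem_range]
    omega
  rw [card_rootedForests, ← sum_subset h]
  · refine sum_congr rfl fun s hs => ?_
    rw [← card_rootedForests_zero hs]
    simp
  · intro s hs hs'
    rw [mem_range] at hs
    rw [mem_Icc] at hs'
    have : s = 0 := by omega
    subst this
    -- The index `0` drops out: a forest on a nonempty set has a component, so it cannot be fully
    -- rooted without roots.
    simp [rootedForests_zero_zero]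

end Solution

end EdgeFamily

theorem mainTheorem8 {V : Type*} [Fintype V] (n : ℕ) (hn : 1 ≤ n) (hV : Fintype.card V = n) :
    (∀ p : ℕ,
      ((Hypergraph.completeAtLeastTwo V).numSpanningHyperforests p : ℚ) =
        ∑ s ∈ Icc 1 n, ((n - 1).choose (s - 1) : ℚ) * (bellPolynomial (n - s)).eval (n : ℚ) *
          ∑ q ∈ range (s + 1 - p),
            (-1 : ℚ) ^ (s - p - q) * (p.choose (s - p - q) : ℚ) *
              (Nat.stirlingSecond (p + q) p : ℚ) *
              ((s.factorial : ℚ) / ((p + q).factorial : ℚ)) ∧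
      ((Hypergraph.completeAtLeastTwo V).numSpanningHyperforests p : ℚ) =
        ∑ s ∈ Icc 1 n, ((n - 1).choose (s - 1) : ℚ) *
          (∑ r ∈ range (n - s + 1), (Nat.stirlingSecond (n - s) r : ℚ) * (n : ℚ) ^ r) *
          ∑ q ∈ range (s + 1 - p),
            (-1 : ℚ) ^ (s - p - q) * (p.choose (s - p - q) : ℚ) *
              (Nat.stirlingSecond (p + q) p : ℚ) *
              ((s.factorial : ℚ) / ((p + q).factorial : ℚ))) ∧
    (Hypergraph.completeAtLeastTwo V).numSpanningHypertrees =
      (Hypergraph.completeAtLeastTwo V).numSpanningHyperforests 1 ∧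
    ((Hypergraph.completeAtLeastTwo V).numSpanningHypertrees : ℚ) =
      ((Hypergraph.completeAtLeastTwo V).numRootedSpanningHypertrees : ℚ) / (n : ℚ) ∧
    ((Hypergraph.completeAtLeastTwo V).numSpanningHypertrees : ℚ) =
      (bellPolynomial (n - 1)).eval (n : ℚ) / (n : ℚ) ∧
    ((Hypergraph.completeAtLeastTwo V).numSpanningHypertrees : ℚ) =
      ∑ r ∈ range n, (Nat.stirlingSecond (n - 1) r : ℚ) * (n : ℚ) ^ ((r : ℤ) - 1) := by

  classical
  subst hV
  have : Nonempty V := Fintype.card_pos_iff.1 hn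
  have hn0 : (Fintype.card V : ℚ) ≠ 0 := by exact_mod_cast (show Fintype.card V ≠ 0 by omega)
  have hforest := fun p => (congrArg (Nat.cast (R := ℚ))
    (EdgeFamily.numSpanningHyperforests_eq (V := V) p)).trans
      (EdgeFamily.card_rootedForests_zero_left p)
  have htree : ((Hypergraph.completeAtLeastTwo V).numSpanningHypertrees : ℚ) =
      (bellPolynomial (Fintype.card V - 1)).eval (Fintype.card V : ℚ) / (Fintype.card V : ℚ) := by
    -- Trees bypass the sum over `s`: `n * a(0, 1) = a(1, 0)`, which is the fully rooted count with
    -- one root.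
    rw [EdgeFamily.numSpanningHypertrees_eq, EdgeFamily.numSpanningHyperforests_eq,
      eq_div_iff hn0, mul_comm, ← Nat.cast_mul, ← EdgeFamily.card_rootedForests_one_zero,
      EdgeFamily.card_rootedForests_zero (mem_Icc.2 ⟨le_rfl, hn⟩)]
    simp
  refine ⟨fun p => ⟨hforest p, ?_⟩, EdgeFamily.numSpanningHypertrees_eq, ?_, htree, ?_⟩
  · rw [hforest p]
    refine sum_congr rfl fun s _ => ?_
    rw [bellPolynomial_eval, forestCoeff]
  · rw [EdgeFamily.numRootedSpanningHypertrees_eq, Nat.cast_mul, mul_div_cancel_right₀ _ hn0]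
  · rw [htree, bellPolynomial_eval, Nat.sub_add_cancel hn, sum_div]
    refine sum_congr rfl fun r _ => ?_
    rw [zpow_sub_one₀ hn0, zpow_natCast]
    ring
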